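/- All spaces are topological spaces; compact and extremally disconnected spaces are not assumed to be Hausdorff unless stated. **Definitions.** For a space $X$ let $RC(X)$ be the Boolean algebra of regular closed subsets of $X$ (sets $F$ with $F=\mathrm{cl}(\mathrm{int}\,F)$), ordered by inclusion, with join $F\cup G$ and zero $\emptyset$; for $x\in X$ put $\sigma_x=\{F\in RC(X): x\in F\}$. A *grill* of $RC(X)$ is a non-empty $\Gamma\subseteq RC(X)$ such that $\emptyset\notin\Gamma$; if $F\in\Gamma$, $G\in RC(X)$ and $F\subseteq G$, then $G\in\Gamma$; and if $F,G\in RC(X)$ and $F\cup G\in\Gamma$, then $F\in\Gamma$ or $G\in\Gamma$. A *clan* of $RC(X)$ is a grill $\Gamma$ with $F\cap G\neq\emptyset$ for all $F,G\in\Gamma$. A $T_0$-space $X$ is *C-semiregular* if every closed subset of $X$ is an intersection of regular closed sets and every clan of $RC(X)$ equals $\sigma_x$ for some $x\in X$. A *C-semiregular extension* of $X$ is a pair $(cX,c)$ where $cX$ is a C-semiregular space and $c:X\to cX$ is a dense embedding. It is *largest* if for every C-semiregular extension $(T,t)$ of $X$ there is a topological embedding $j:T\to cX$ with $j\circ t=c$.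 For an extremally disconnected compact Hausdorff space $Y$, let $\gamma Y$ be the set of all grills of $RC(Y)$ with the topology for which the sets $\{\Gamma\in\gamma Y: F\in\Gamma\}$, $F\in RC(Y)$, form a base for the closed sets, and let $\gamma_Y:Y\to\gamma Y$, $\gamma_Y(y)=\sigma_y$. **Theorem 9.3.** Let $X$ and $Y$ be extremally disconnected compact Hausdorff spaces and let $f:X\to Y$ be a continuous map. Then $(\gamma X,\gamma_X)$ and $(\gamma Y,\gamma_Y)$ are the largest C-semiregular extensions of $X$ and $Y$, and for every C-semiregular extension $(cX,c)$ of $X$ there exists a continuous map $f':cX\to\gamma Y$ such that $\gamma_Y\circ f=f'\circ c$. In particular, there exists a continuous map $\gamma f:\gamma X\to\gamma Y$ such that $\gamma_Y\circ f=\gamma f\circ\gamma_X$. -/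

import Mathlib

open Set Topology

/-- `F` is a regular closed subset: `F = cl (int F)`. -/
def IsRegClosed {X : Type*} [TopologicalSpace X] (F : Set X) : Prop :=
  F = closure (interior F)

/-- `Γ` is a grill of the Boolean algebra `RC(X)` of regular closed subsets of `X`, whose order is
inclusion, whose join is union and whose zero is the empty set. -/
structure IsGrillRC {X : Type*} [TopologicalSpace X] (Γ : Set (Set X)) : Prop where
  regClosed : ∀ F ∈ Γ, IsRegClosed F
  nonempty : Γ.Nonempty
  empty_notMem : ∅ ∉ Γ
  mono : ∀ F ∈ Γ, ∀ G, IsRegClosed G → F ⊆ G → G ∈ Γ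
  union : ∀ F G, IsRegClosed F → IsRegClosed G → F ∪ G ∈ Γ → F ∈ Γ ∨ G ∈ Γ

/-- `Γ` is a clan of the contact algebra `(RC(X), C_X)`: a grill any two members of which are in
contact, where `F C_X G` means that `F ∩ G` is nonempty. -/
structure IsClanRC {X : Type*} [TopologicalSpace X] (Γ : Set (Set X)) : Prop
    extends IsGrillRC Γ where
  contact : ∀ F ∈ Γ, ∀ G ∈ Γ, (F ∩ G).Nonempty

/-- `σ_x`, the family of all regular closed sets that contain `x`. -/
def sigmaRC {X : Type*} [TopologicalSpace X] (x : X) : Set (Set X) :=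
  {F | IsRegClosed F ∧ x ∈ F}

/-- `X` is semiregular: the regular closed sets form a base for the closed sets, i.e. every closed
set is an intersection of regular closed sets. -/
def IsSemiregularSpace (X : Type*) [TopologicalSpace X] : Prop :=
  ∀ A : Set X, IsClosed A → ∃ S : Set (Set X), (∀ F ∈ S, IsRegClosed F) ∧ A = ⋂₀ S

/-- `X` is C-semiregular: a semiregular `T₀`-space in which every clan of `(RC(X), C_X)` is of the
form `σ_x` for some point `x`. -/
structure IsCSemiregularSpace (X : Type*) [TopologicalSpace X] : Prop where
  t0 : T0Space X
  semiregular : IsSemiregularSpace X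
  clan : ∀ Γ : Set (Set X), IsClanRC Γ → ∃ x : X, Γ = sigmaRC x

/-- `(cX, c)` is a C-semiregular extension of `X`. -/
structure IsCSemiregularExtension {X : Type*} {cX : Type*} [TopologicalSpace X]
    [TopologicalSpace cX] (c : X → cX) : Prop where
  csemiregular : IsCSemiregularSpace cX
  denseEmbedding : IsDenseEmbedding c

universe u v w

/-- `(Z, g)` is a largest C-semiregular extension of `Y` with respect to the injective order: for
every C-semiregular extension `(T, t)` of `Y` there is an embedding `j : T → Z` with
`j ∘ t = g`. -/
structure IsLargestCSemiregularExtension {Y : Type u} {Z : Type v} [TopologicalSpace Y]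
    [TopologicalSpace Z] (g : Y → Z) : Prop where
  extension : IsCSemiregularExtension g
  largest : ∀ (T : Type w) [TopologicalSpace T] (t : Y → T), IsCSemiregularExtension t →
    ∃ j : T → Z, IsEmbedding j ∧ j ∘ t = g

/-- `γY`, the set of all grills of `RC(Y)`. -/
def GammaSpace (Y : Type u) [TopologicalSpace Y] : Type u :=
  {Γ : Set (Set Y) // IsGrillRC Γ}

/-- The topology of `γY` has the sets `{Γ | F ∈ Γ}`, `F ∈ RC(Y)`, as a base for the closed sets.
(The complements of these sets are closed under finite intersections, by the grill axioms.) -/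
instance (Y : Type u) [TopologicalSpace Y] : TopologicalSpace (GammaSpace Y) :=
  TopologicalSpace.generateFrom
    {U | ∃ F : Set Y, IsRegClosed F ∧ U = {Γ : GammaSpace Y | F ∈ Γ.1}ᶜ}

theorem isGrillRC_sigmaRC {Y : Type*} [TopologicalSpace Y] (y : Y) : IsGrillRC (sigmaRC y) where
  regClosed _ hF := hF.1
  nonempty := ⟨univ, by simp [sigmaRC, IsRegClosed]⟩
  empty_notMem h := h.2
  mono _ hF _ hG hFG := ⟨hG, hFG hF.2⟩
  union _ _ hF hG h := h.2.imp (fun h => ⟨hF, h⟩) (fun h => ⟨hG, h⟩)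

/-- `γ_Y : Y → γY`, sending `y` to the family of all regular closed sets that contain `y`. (If `Y`
is extremally disconnected, then `RC(Y) = CO(Y)` and this is the ultrafilter of all clopen sets
containing `y`.) -/
def gammaMap (Y : Type u) [TopologicalSpace Y] (y : Y) : GammaSpace Y :=
  ⟨sigmaRC y, isGrillRC_sigmaRC y⟩

/-!
The proof rests on two remarks.

If `c : X → T` is a dense embedding, then `F ↦ cl (c F)` maps `RC(X)` onto `RC(T)`, with inverse
`A ↦ c⁻¹ A` (`IsDenseEmbedding.preimage_closure_image`, `IsRegClosed.closure_image_preimage`).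
Write `F̂ = {Γ | F ∈ Γ}` for the basic closed sets of `γX`. When `X` is extremally disconnected,
`RC(X)` consists of the clopen sets; when `X` is compact Hausdorff as well, these form a base, so
that `γ_X` is a dense embedding. Moreover `F̂ = cl (γ_X F)`, hence the sets `F̂` are exactly the
regular closed subsets of `γX`, and a clan of `RC(γX)` is `σ_Γ` for the grill `Γ = {F | F̂ ∈ clan}`.

For a dense embedding `c : X → T` and a continuous map `f` from `X` to an extremally disconnected
space `Y`, each point `z` of `T` yields the grill `{G ∈ RC(Y) | z ∈ cl (c (f⁻¹ G))}`
(`traceGrill`). This map `T → γY` is continuous because the preimage of `Ĝ` is `cl (c (f⁻¹ G))`,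
and it extends `γ_Y ∘ f`. When `f` is the identity, the preimages of the basic closed sets are all
the regular closed sets of `T`; if `T` is a semiregular `T₀`-space, these determine both
the topology and the points, and the map is an embedding.
-/

/-! ### Regular closed sets -/

theorem IsRegClosed.isClosed {X : Type*} [TopologicalSpace X] {F : Set X} (hF : IsRegClosed F) :
    IsClosed F := by
  rw [hF]
  exact isClosed_closure

theorem IsClopen.isRegClosed {X : Type*} [TopologicalSpace X] {F : Set X} (hF : IsClopen F) :
    IsRegClosed F := by
  rw [IsRegClosed, hF.isOpen.interior_eq, hF.isClosed.closure_eq]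

theorem IsOpen.isRegClosed_closure {X : Type*} [TopologicalSpace X] {U : Set X} (hU : IsOpen U) :
    IsRegClosed (closure U) :=
  Subset.antisymm (closure_mono (interior_maximal subset_closure hU))
    (closure_minimal interior_subset isClosed_closure)

theorem isRegClosed_union {Y : Type*} [TopologicalSpace Y] {F G : Set Y} (hF : IsRegClosed F)
    (hG : IsRegClosed G) : IsRegClosed (F ∪ G) := by
  refine Subset.antisymm ?_ (closure_minimal interior_subset (hF.isClosed.union hG.isClosed))
  refine union_subset ?_ ?_
  · conv_lhs => rw [hF]
    exact closure_mono (interior_mono subset_union_left)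
  · conv_lhs => rw [hG]
    exact closure_mono (interior_mono subset_union_right)

theorem isRegClosed_iff_isClopen {X : Type*} [TopologicalSpace X] [ExtremallyDisconnected X]
    {F : Set X} : IsRegClosed F ↔ IsClopen F := by
  refine ⟨fun hF => ⟨hF.isClosed, ?_⟩, IsClopen.isRegClosed⟩
  rw [hF]
  exact ExtremallyDisconnected.open_closure _ isOpen_interior

theorem IsDenseEmbedding.closure_inter_range {X T : Type*} [TopologicalSpace X]
    [TopologicalSpace T] {c : X → T} (hc : IsDenseEmbedding c) {U : Set T} (hU : IsOpen U) :
    closure (U ∩ range c) = closure U :=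
  Subset.antisymm (closure_mono inter_subset_left)
    (closure_minimal (Dense.open_subset_closure_inter hc.dense hU) isClosed_closure)

theorem IsDenseEmbedding.preimage_closure_image {X T : Type*} [TopologicalSpace X]
    [TopologicalSpace T] {c : X → T} (hc : IsDenseEmbedding c) {F : Set X} (hF : IsClosed F) :
    c ⁻¹' closure (c '' F) = F := by
  rw [← hc.isEmbedding.isInducing.closure_eq_preimage_closure_image, hF.closure_eq]

theorem IsRegClosed.closure_image_preimage {X T : Type*} [TopologicalSpace X]
    [TopologicalSpace T] {c : X → T} (hc : IsDenseEmbedding c) {A : Set T} (hA : IsRegClosed A) :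
    closure (c '' (c ⁻¹' A)) = A := by
  refine Subset.antisymm (closure_minimal (image_preimage_subset c A) hA.isClosed) ?_
  have h : A = closure (interior A ∩ range c) := by
    rw [hc.closure_inter_range isOpen_interior]
    exact hA
  conv_lhs => rw [h]
  rw [image_preimage_eq_inter_range]
  exact closure_mono (inter_subset_inter_left _ interior_subset)

theorem IsRegClosed.preimage_of_isDenseEmbedding {X T : Type*} [TopologicalSpace X]
    [TopologicalSpace T] {c : X → T} (hc : IsDenseEmbedding c) {A : Set T} (hA : IsRegClosed A) :
    IsRegClosed (c ⁻¹' A) := by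
  have h : c ⁻¹' A = closure (c ⁻¹' interior A) := by
    rw [hc.isEmbedding.isInducing.closure_eq_preimage_closure_image,
      image_preimage_eq_inter_range, hc.closure_inter_range isOpen_interior, ← hA]
  rw [h]
  exact (isOpen_interior.preimage hc.isEmbedding.continuous).isRegClosed_closure

/-! ### The space of grills -/

/-- The basic closed set `F̂ = {Γ ∈ γY | F ∈ Γ}`. -/
def gammaBasic {Y : Type*} [TopologicalSpace Y] (F : Set Y) : Set (GammaSpace Y) :=
  {Γ | F ∈ Γ.1}

theorem isClosed_gammaBasic {Y : Type*} [TopologicalSpace Y] {F : Set Y} (hF : IsRegClosed F) :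
    IsClosed (gammaBasic F) :=
  ⟨TopologicalSpace.isOpen_generateFrom_of_mem ⟨F, hF, rfl⟩⟩

theorem gammaBasic_union {Y : Type*} [TopologicalSpace Y] {F G : Set Y} (hF : IsRegClosed F)
    (hG : IsRegClosed G) (hFG : IsRegClosed (F ∪ G)) :
    gammaBasic (F ∪ G) = gammaBasic F ∪ gammaBasic G := by
  ext Γ
  exact ⟨Γ.2.union F G hF hG, Or.rec (fun h => Γ.2.mono F h _ hFG subset_union_left)
    (fun h => Γ.2.mono G h _ hFG subset_union_right)⟩

theorem gammaBasic_empty {Y : Type*} [TopologicalSpace Y] :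
    gammaBasic (∅ : Set Y) = ∅ :=
  eq_empty_of_forall_notMem fun Γ => Γ.2.empty_notMem

theorem gammaBasic_mono {Y : Type*} [TopologicalSpace Y] {F G : Set Y} (hG : IsRegClosed G)
    (hFG : F ⊆ G) : gammaBasic F ⊆ gammaBasic G :=
  fun Γ h => Γ.2.mono F h G hG hFG

theorem continuous_gammaSpace_iff {T Y : Type*} [TopologicalSpace T] [TopologicalSpace Y]
    {g : T → GammaSpace Y} :
    Continuous g ↔ ∀ G : Set Y, IsRegClosed G → IsClosed (g ⁻¹' gammaBasic G) := by
  refine ⟨fun h G hG => (isClosed_gammaBasic hG).preimage h, fun h => ?_⟩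
  refine continuous_generateFrom_iff.2 ?_
  rintro _ ⟨F, hF, rfl⟩
  exact (h F hF).isOpen_compl

/-- A point outside a closed set `A` of `γY` is separated from it by one of the sets `F̂`. The
grill axiom for unions is what makes these sets a base, and not merely a subbase. -/
theorem exists_gammaBasic_of_notMem {Y : Type*} [TopologicalSpace Y] {A : Set (GammaSpace Y)}
    (hA : IsClosed A) {Γ : GammaSpace Y} (hΓ : Γ ∉ A) :
    ∃ F : Set Y, IsRegClosed F ∧ A ⊆ gammaBasic F ∧ Γ ∉ gammaBasic F := by
  suffices h : ∀ U : Set (GammaSpace Y),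
      TopologicalSpace.GenerateOpen
        {U | ∃ F : Set Y, IsRegClosed F ∧ U = {Γ : GammaSpace Y | F ∈ Γ.1}ᶜ} U →
      Γ ∈ U → ∃ F : Set Y, IsRegClosed F ∧ Uᶜ ⊆ gammaBasic F ∧ Γ ∉ gammaBasic F by
    simpa using h Aᶜ hA.isOpen_compl hΓ
  intro U hU hΓU
  induction hU with
  | basic s hs =>
    obtain ⟨F, hF, rfl⟩ := hs
    exact ⟨F, hF, by rw [compl_compl]; rfl, hΓU⟩
  | univ => exact ⟨∅, isClopen_empty.isRegClosed, by simp, Γ.2.empty_notMem⟩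
  | inter s t _ _ ihs iht =>
    obtain ⟨F, hF, hsF, hΓF⟩ := ihs hΓU.1
    obtain ⟨G, hG, htG, hΓG⟩ := iht hΓU.2
    refine ⟨F ∪ G, isRegClosed_union hF hG, ?_, ?_⟩ <;>
      rw [gammaBasic_union hF hG (isRegClosed_union hF hG)]
    · rw [compl_inter]
      exact union_subset_union hsF htG
    · exact fun h => h.elim hΓF hΓG
  | sUnion S _ ih =>
    obtain ⟨s, hs, hΓs⟩ := hΓU
    obtain ⟨F, hF, hsF, hΓF⟩ := ih s hs hΓs
    exact ⟨F, hF, (compl_subset_compl.2 (subset_sUnion_of_mem hs)).trans hsF, hΓF⟩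

theorem preimage_gammaBasic_gammaMap {Y : Type*} [TopologicalSpace Y] {F : Set Y}
    (hF : IsRegClosed F) : gammaMap Y ⁻¹' gammaBasic F = F := by
  ext y
  exact ⟨fun h => h.2, fun h => ⟨hF, h⟩⟩

theorem denseRange_gammaMap (Y : Type*) [TopologicalSpace Y] : DenseRange (gammaMap Y) := by
  intro Γ
  by_contra hΓ
  obtain ⟨F, hF, hsub, hΓF⟩ := exists_gammaBasic_of_notMem isClosed_closure hΓ
  have hFuniv : F = univ := eq_univ_of_forall fun y =>
    (hsub (subset_closure (mem_range_self y)) : F ∈ sigmaRC y).2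
  obtain ⟨G, hG⟩ := Γ.2.nonempty
  exact hΓF (Γ.2.mono G hG F hF (hFuniv ▸ subset_univ G))

theorem isDenseEmbedding_gammaMap (Y : Type*) [TopologicalSpace Y] [CompactSpace Y] [T2Space Y]
    [ExtremallyDisconnected Y] : IsDenseEmbedding (gammaMap Y) := by
  have hcont : Continuous (gammaMap Y) := continuous_gammaSpace_iff.2 fun F hF => by
    rw [preimage_gammaBasic_gammaMap hF]
    exact hF.isClosed
  have hind : IsInducing (gammaMap Y) := by
    refine ⟨le_antisymm hcont.le_induced ?_⟩
    refine le_of_le_of_eq (le_generateFrom fun U hU => ?_)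
      (isTopologicalBasis_isClopen (X := Y)).eq_generateFrom.symm
    have hUc : IsRegClosed Uᶜ := IsClopen.isRegClosed (IsClopen.compl hU)
    refine ⟨(gammaBasic Uᶜ)ᶜ, (isClosed_gammaBasic hUc).isOpen_compl, ?_⟩
    rw [preimage_compl, preimage_gammaBasic_gammaMap hUc, compl_compl]
  exact { toIsInducing := hind, dense := denseRange_gammaMap Y, injective := hind.injective }

/-! ### C-semiregularity of the space of grills -/

/-- The inclusion `γ_Y F ⊆ Ĝ` means `F ⊆ G`, so that every grill containing `F` then lies in `Ĝ`;
thus `F̂` is the least basic closed set that contains `γ_Y F`. -/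
theorem closure_image_gammaMap {Y : Type*} [TopologicalSpace Y] {F : Set Y} (hF : IsRegClosed F) :
    closure (gammaMap Y '' F) = gammaBasic F := by
  refine Subset.antisymm (closure_minimal ?_ (isClosed_gammaBasic hF)) fun Γ hΓ => ?_
  · exact image_subset_iff.2 (preimage_gammaBasic_gammaMap hF).ge
  · by_contra h
    obtain ⟨G, hG, hsub, hΓG⟩ := exists_gammaBasic_of_notMem isClosed_closure h
    refine hΓG (gammaBasic_mono hG ?_ hΓ)
    have := image_subset_iff.1 (subset_closure.trans hsub)
    rwa [preimage_gammaBasic_gammaMap hG] at this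

/-- The set `{Γ | Fᶜ ∉ Γ}` is open and contains `γ_Y F`, which is dense in `F̂`. It is contained in
`F̂`, for `F ∪ Fᶜ`, the largest element of `RC(Y)`, belongs to every grill. -/
theorem isRegClosed_gammaBasic {Y : Type*} [TopologicalSpace Y] [ExtremallyDisconnected Y]
    {F : Set Y} (hF : IsRegClosed F) : IsRegClosed (gammaBasic F) := by
  have hFc : IsRegClosed Fᶜ := (isRegClosed_iff_isClopen.1 hF).compl.isRegClosed
  refine Subset.antisymm ?_ (closure_minimal interior_subset (isClosed_gammaBasic hF))
  rw [← closure_image_gammaMap hF]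
  refine closure_mono ?_
  rw [closure_image_gammaMap hF]
  have hsub : (gammaBasic Fᶜ)ᶜ ⊆ gammaBasic F := fun Γ hΓ => by
    obtain ⟨G, hG⟩ := Γ.2.nonempty
    have huniv : F ∪ Fᶜ ∈ Γ.1 :=
      Γ.2.mono G hG _ (isRegClosed_union hF hFc) (by rw [union_compl_self]; exact subset_univ G)
    exact (Γ.2.union F Fᶜ hF hFc huniv).resolve_right hΓ
  refine Subset.trans ?_ (interior_maximal hsub (isClosed_gammaBasic hFc).isOpen_compl)
  rintro _ ⟨y, hy, rfl⟩ h
  exact h.2 hy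

theorem t0Space_gammaSpace (Y : Type*) [TopologicalSpace Y] : T0Space (GammaSpace Y) := by
  refine ⟨fun Γ Δ h => Subtype.ext (Set.ext fun F => ?_)⟩
  have key : ∀ Γ Δ : GammaSpace Y, Inseparable Γ Δ → F ∈ Γ.1 → F ∈ Δ.1 := fun Γ Δ h hF =>
    (h.mem_closed_iff (isClosed_gammaBasic (Γ.2.regClosed F hF))).1 hF
  exact ⟨key Γ Δ h, key Δ Γ h.symm⟩

theorem isCSemiregularExtension_gammaMap (Y : Type*) [TopologicalSpace Y] [CompactSpace Y]
    [T2Space Y] [ExtremallyDisconnected Y] : IsCSemiregularExtension (gammaMap Y) := by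
  have hde := isDenseEmbedding_gammaMap Y
  have hreg : ∀ A : Set (GammaSpace Y), IsRegClosed A →
      ∃ F : Set Y, IsRegClosed F ∧ A = gammaBasic F := fun A hA => by
    have hF := hA.preimage_of_isDenseEmbedding hde
    exact ⟨_, hF, by rw [← closure_image_gammaMap hF, hA.closure_image_preimage hde]⟩
  refine ⟨⟨t0Space_gammaSpace Y, fun A hA => ?_, fun C hC => ?_⟩, hde⟩
  · refine ⟨{B | IsRegClosed B ∧ A ⊆ B}, fun B hB => hB.1,
      Subset.antisymm (subset_sInter fun B hB => hB.2) fun Γ hΓ => ?_⟩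
    by_contra h
    obtain ⟨F, hF, hsub, hΓF⟩ := exists_gammaBasic_of_notMem hA h
    exact hΓF (hΓ _ ⟨isRegClosed_gammaBasic hF, hsub⟩)
  · have hgrill : IsGrillRC {F : Set Y | IsRegClosed F ∧ gammaBasic F ∈ C} :=
      { regClosed := fun F hF => hF.1
        nonempty := by
          obtain ⟨A, hA⟩ := hC.nonempty
          obtain ⟨F, hF, rfl⟩ := hreg A (hC.regClosed A hA)
          exact ⟨F, hF, hA⟩
        empty_notMem := fun h => hC.empty_notMem (gammaBasic_empty (Y := Y) ▸ h.2)
        mono := fun F hF G hG hFG => ⟨hG, hC.mono _ hF.2 _ (isRegClosed_gammaBasic hG)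
          (gammaBasic_mono hG hFG)⟩
        union := fun F G hF hG h => by
          have h2 := h.2
          rw [gammaBasic_union hF hG h.1] at h2
          exact (hC.union _ _ (isRegClosed_gammaBasic hF) (isRegClosed_gammaBasic hG) h2).imp
            (fun h => ⟨hF, h⟩) (fun h => ⟨hG, h⟩) }
    refine ⟨⟨_, hgrill⟩, Set.ext fun A => ⟨fun hA => ?_, fun hA => ?_⟩⟩
    · obtain ⟨F, hF, rfl⟩ := hreg A (hC.regClosed A hA)
      exact ⟨isRegClosed_gammaBasic hF, hF, hA⟩
    · obtain ⟨F, hF, rfl⟩ := hreg A hA.1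
      exact hA.2.2

/-! ### Maps from dense extensions into the space of grills -/

section TraceGrill

variable {X T Y : Type*} [TopologicalSpace T] [TopologicalSpace Y]

/-- The grill `{G ∈ RC(Y) | z ∈ cl (c (f⁻¹ G))}` of a point `z` in an extension `c : X → T`, for a
map `f : X → Y`. -/
def traceGrill {c : X → T} (hc : DenseRange c) (f : X → Y) (z : T) : GammaSpace Y :=
  ⟨{G | IsRegClosed G ∧ z ∈ closure (c '' (f ⁻¹' G))},
    { regClosed := fun _ hG => hG.1
      nonempty := ⟨univ, isClopen_univ.isRegClosed, by
        rw [preimage_univ, image_univ]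
        exact hc z⟩
      empty_notMem := fun h => by simpa using h.2
      mono := fun _ hF _ hG hFG =>
        ⟨hG, closure_mono (image_mono (preimage_mono hFG)) hF.2⟩
      union := fun F G hF hG h => by
        have h2 := h.2
        rw [preimage_union, image_union, closure_union] at h2
        exact h2.imp (fun h => ⟨hF, h⟩) (fun h => ⟨hG, h⟩) }⟩

theorem preimage_gammaBasic_traceGrill {c : X → T} (hc : DenseRange c) (f : X → Y) {G : Set Y}
    (hG : IsRegClosed G) :
    traceGrill hc f ⁻¹' gammaBasic G = closure (c '' (f ⁻¹' G)) := by
  ext z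
  exact ⟨fun h => h.2, fun h => ⟨hG, h⟩⟩

theorem continuous_traceGrill {c : X → T} (hc : DenseRange c) (f : X → Y) :
    Continuous (traceGrill hc f) := continuous_gammaSpace_iff.2 fun G hG => by
  rw [preimage_gammaBasic_traceGrill hc f hG]
  exact isClosed_closure

theorem gammaMap_comp_eq_traceGrill_comp [TopologicalSpace X] {c : X → T}
    (hc : IsDenseEmbedding c) {f : X → Y} (hf : Continuous f) :
    gammaMap Y ∘ f = traceGrill hc.dense f ∘ c := by
  refine funext fun x => Subtype.ext (Set.ext fun G => and_congr_right fun hG => ?_)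
  exact Set.ext_iff.1 (hc.preimage_closure_image (hG.isClosed.preimage hf)).symm x

/-- The preimages of the basic closed sets are all the regular closed subsets of `T`. -/
theorem isEmbedding_traceGrill_id [TopologicalSpace X] [T0Space T] (hT : IsSemiregularSpace T)
    {c : X → T} (hc : IsDenseEmbedding c) : IsEmbedding (traceGrill hc.dense (id : X → X)) := by
  have hind : IsInducing (traceGrill hc.dense (id : X → X)) := by
    refine isInducing_iff_nhds.2 fun z => le_antisymm
      (continuous_traceGrill hc.dense id).continuousAt.le_comap fun U hU => ?_
    obtain ⟨V, hVU, hV, hzV⟩ := mem_nhds_iff.1 hU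
    obtain ⟨S, hS, hVS⟩ := hT Vᶜ hV.isClosed_compl
    obtain ⟨A, hA, hzA⟩ : ∃ A ∈ S, z ∉ A := by
      have hz : z ∉ ⋂₀ S := hVS ▸ fun h => h hzV
      simpa using hz
    have hF := (hS A hA).preimage_of_isDenseEmbedding hc
    have hpre : traceGrill hc.dense (id : X → X) ⁻¹' gammaBasic (c ⁻¹' A) = A := by
      rw [preimage_gammaBasic_traceGrill hc.dense id hF, preimage_id,
        (hS A hA).closure_image_preimage hc]
    refine ⟨(gammaBasic (c ⁻¹' A))ᶜ, (isClosed_gammaBasic hF).isOpen_compl.mem_nhds ?_, ?_⟩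
    · exact fun h => hzA (hpre ▸ h)
    · rw [preimage_compl, hpre]
      exact (compl_subset_comm.1 (hVS ▸ sInter_subset_of_mem hA)).trans hVU
  exact ⟨hind, hind.injective⟩

end TraceGrill

theorem isLargestCSemiregularExtension_gammaMap (Y : Type u) [TopologicalSpace Y] [CompactSpace Y]
    [T2Space Y] [ExtremallyDisconnected Y] :
    IsLargestCSemiregularExtension.{u, u, w} (gammaMap Y) where
  extension := isCSemiregularExtension_gammaMap Y
  largest _ _ _ ht :=
    haveI := ht.csemiregular.t0
    ⟨traceGrill ht.denseEmbedding.dense id,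
      isEmbedding_traceGrill_id ht.csemiregular.semiregular ht.denseEmbedding,
      (gammaMap_comp_eq_traceGrill_comp ht.denseEmbedding continuous_id).symm⟩

theorem theorem9p3
    {X : Type u} [TopologicalSpace X] [CompactSpace X] [T2Space X] [ExtremallyDisconnected X]
    {Y : Type v} [TopologicalSpace Y] [CompactSpace Y] [T2Space Y] [ExtremallyDisconnected Y]
    (f : X → Y) (hf : Continuous f) :
    -- `(γX, γ_X)` and `(γY, γ_Y)` are the largest C-semiregular extensions of `X` and `Y`
    IsLargestCSemiregularExtension.{u, u, w} (gammaMap X) ∧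
    IsLargestCSemiregularExtension.{v, v, w} (gammaMap Y) ∧
    -- `f` extends over every C-semiregular extension of `X`
    (∀ (cX : Type w) [TopologicalSpace cX] (c : X → cX), IsCSemiregularExtension c →
      ∃ f' : cX → GammaSpace Y, Continuous f' ∧ gammaMap Y ∘ f = f' ∘ c) ∧
    -- in particular, over `γX`
    (∃ γf : GammaSpace X → GammaSpace Y, Continuous γf ∧ gammaMap Y ∘ f = γf ∘ gammaMap X) :=
  ⟨isLargestCSemiregularExtension_gammaMap X, isLargestCSemiregularExtension_gammaMap Y,
    fun _ _ _ hc => ⟨traceGrill hc.denseEmbedding.dense f, continuous_traceGrill _ f,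
      gammaMap_comp_eq_traceGrill_comp hc.denseEmbedding hf⟩,
    ⟨traceGrill (isDenseEmbedding_gammaMap X).dense f, continuous_traceGrill _ f,
      gammaMap_comp_eq_traceGrill_comp (isDenseEmbedding_gammaMap X) hf⟩⟩
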